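/- Let $X$ be a non-empty compact metric space with metric $d$, $T:X\to X$ a continuous map and $f:X\to\mathbb R$ a continuous function. For $n\in\mathbb N$ put $S_nf(x)=\sum_{j=0}^{n-1}f(T^jx)$, $d_n(x,y)=\max_{0\le j\le n-1}d(T^jx,T^jy)$, $B_n(x,\delta)=\{y:d_n(x,y)<\delta\}$ and $\overline B_n(x,\delta)=\{y:d_n(x,y)\le\delta\}$. For non-empty $Z\subset X$ and $\delta>0$ define the following quantities, with values in $[-\infty,\infty]$. (i) A set $E\subset X$ is $(n,\delta)$-spanning for $Z$ if every $x\in Z$ has some $y\in E$ with $d_n(x,y)<\delta$. Let $P_n(Z,\delta)=\inf_E\sum_{x\in E}(1/\delta)^{S_nf(x)}$ over all such $E$, let $P(Z,\delta)=\limsup_{n\to\infty}\frac1n\log P_n(Z,\delta)$, and define the upper metric mean dimension with potential $f$ of $Z$ by $$\overline{\mathrm{mdim}}_M(T,f,Z,d)=\limsup_{\delta\to0}\frac{P(Z,\delta)}{\log(1/\delta)}.$$ (ii) For $s\in\mathbb R$ and $N\in\mathbb N$ let $M^s_{N,\delta}(Z)=\inf\sum_{i\in I}e^{-n_is+\log(1/\delta)\,S_{n_i}f(x_i)}$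 over all finite or countable covers $\{B_{n_i}(x_i,\delta)\}_{i\in I}$ of $Z$ with $n_i\ge N$, $x_i\in X$. Let $M^s_\delta(Z)=\lim_{N\to\infty}M^s_{N,\delta}(Z)$ and $M_\delta(Z)=\inf\{s:M^s_\delta(Z)=0\}$, and define the Bowen upper metric mean dimension with potential $f$ on $Z$ by $$\overline{\mathrm{mdim}}^B_M(T,f,Z,d)=\limsup_{\delta\to0}\frac{M_\delta(Z)}{\log(1/\delta)}.$$ (iii) For $A\subset X$, $s\in\mathbb R$ and $N\in\mathbb N$ let $P^s_{N,\delta}(A)=\sup\sum_{i\in I}e^{-n_is+\log(1/\delta)\,S_{n_i}f(x_i)}$ over all finite or countable pairwise disjoint families $\{\overline B_{n_i}(x_i,\delta)\}_{i\in I}$ with $n_i\ge N$, $x_i\in A$. Let $P^s_\delta(A)=\lim_{N\to\infty}P^s_{N,\delta}(A)$, $\mathcal P^s_\delta(Z)=\inf\{\sum_{i\ge1}P^s_\delta(Z_i):Z\subset\bigcup_{i\ge1}Z_i\}$ and $\mathcal P_\delta(Z)=\inf\{s:\mathcal P^s_\delta(Z)=0\}$, and define the packing upper metric mean dimension with potential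 $f$ on $Z$ by $$\overline{\mathrm{mdim}}^P_M(T,f,Z,d)=\limsup_{\delta\to0}\frac{\mathcal P_\delta(Z)}{\log(1/\delta)}.$$ Then for every $\epsilon>0$ and all integers $n\ge m\ge0$, writing $W^s_{\epsilon,[m,n]}(x,T)=\{y\in X:d(T^jx,T^jy)\le\epsilon\text{ for all }m\le j\le n\}$ for the $(m,n)$-block of the $\epsilon$-stable set of $x$, $$\overline{\mathrm{mdim}}_M(T,f,X,d)=\max_{x\in X}\overline{\mathrm{mdim}}^B_M(T,f,W^s_{\epsilon,[m,n]}(x,T),d)=\max_{x\in X}\overline{\mathrm{mdim}}^P_M(T,f,W^s_{\epsilon,[m,n]}(x,T),d)=\max_{x\in X}\overline{\mathrm{mdim}}_M(T,f,W^s_{\epsilon,[m,n]}(x,T),d),$$ where all three maxima are attained. (The case $f=0$ gives the corresponding equalities for the metric mean dimensions without potential.) -/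

import Mathlib

open Filter Topology
open scoped NNReal ENNReal

noncomputable section

namespace MeanDim

variable {X : Type*} [MetricSpace X]

/-- The Bowen metric `d_n(x, y) = max_{0 ≤ j ≤ n - 1} d(T^j x, T^j y)`. -/
def bowenDist (T : X → X) (n : ℕ) (x y : X) : ℝ :=
  (((Finset.range n).sup fun j => nndist (T^[j] x) (T^[j] y) : ℝ≥0) : ℝ)

/-- The open Bowen ball `B_n(x, ε)`. -/
def bowenBall (T : X → X) (n : ℕ) (x : X) (ε : ℝ) : Set X :=
  {y | bowenDist T n x y < ε}

/-- The closed Bowen ball. -/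
def closedBowenBall (T : X → X) (n : ℕ) (x : X) (ε : ℝ) : Set X :=
  {y | bowenDist T n x y ≤ ε}

/-- The `(m, n)`-block of the `ε`-stable set of `x`. -/
def stableBlock (T : X → X) (ε : ℝ) (m n : ℕ) (x : X) : Set X :=
  {y | ∀ j ∈ Finset.Icc m n, dist (T^[j] x) (T^[j] y) ≤ ε}

/-- `E ⊆ X` is an `(n, ε)`-spanning set of `Z`. -/
def IsSpanningSet (T : X → X) (n : ℕ) (ε : ℝ) (Z E : Set X) : Prop :=
  ∀ x ∈ Z, ∃ y ∈ E, bowenDist T n x y < ε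

/-- `P_n(T, f, Z, d, ε) = inf_E ∑_{x ∈ E} (1/ε)^{S_n f(x)}` over the `(n, ε)`-spanning sets `E`
of `Z`; here `S_n f(x) = birkhoffSum T f n x`. -/
def spanningSum (T : X → X) (f : X → ℝ) (Z : Set X) (ε : ℝ) (n : ℕ) : ℝ≥0∞ :=
  ⨅ (E : Set X) (_ : IsSpanningSet T n ε Z E),
    ∑' x : E, ENNReal.ofReal ((1 / ε) ^ birkhoffSum T f n (x : X))

/-- `P(T, f, Z, d, ε) = limsup_n (1/n) log P_n(T, f, Z, d, ε)`. -/
def spanningPressure (T : X → X) (f : X → ℝ) (Z : Set X) (ε : ℝ) : EReal :=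
  limsup (fun n : ℕ => ENNReal.log (spanningSum T f Z ε n) / (n : EReal)) atTop

/-- The upper metric mean dimension with potential `f` of `Z`. -/
def upperMdim (T : X → X) (f : X → ℝ) (Z : Set X) : EReal :=
  limsup (fun ε : ℝ => spanningPressure T f Z ε / ((Real.log (1 / ε) : ℝ) : EReal)) (𝓝[>] 0)

/-- The weight `exp(-n s + log(1/ε) S_n f(x))` of the Bowen ball of length `n = p.1` and
centre `x = p.2`. -/
def ballWeight (T : X → X) (f : X → ℝ) (ε s : ℝ) (p : ℕ × X) : ℝ≥0∞ :=
  ENNReal.ofReal (Real.exp (-(p.1 : ℝ) * s + Real.log (1 / ε) * birkhoffSum T f p.1 p.2))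

/-- A countable family `{B_{n_i}(x_i, ε)}` with `n_i ≥ N`, `x_i ∈ X` that covers `Z`, given as the
set of its pairs `(n_i, x_i)`. -/
def IsBowenCover (T : X → X) (Z : Set X) (ε : ℝ) (N : ℕ) (C : Set (ℕ × X)) : Prop :=
  C.Countable ∧ (∀ p ∈ C, N ≤ p.1) ∧ Z ⊆ ⋃ p ∈ C, bowenBall T p.1 p.2 ε

/-- `M_{N,ε}^s(T, f, Z, d)`. -/
def bowenPre (T : X → X) (f : X → ℝ) (Z : Set X) (ε s : ℝ) (N : ℕ) : ℝ≥0∞ :=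
  ⨅ (C : Set (ℕ × X)) (_ : IsBowenCover T Z ε N C), ∑' p : C, ballWeight T f ε s p

/-- `M_ε^s(T, f, Z, d)`: the limit of `M_{N,ε}^s` as `N → ∞`, which is a supremum because
`M_{N,ε}^s` is nondecreasing in `N`. -/
def bowenOuter (T : X → X) (f : X → ℝ) (Z : Set X) (ε s : ℝ) : ℝ≥0∞ :=
  ⨆ N : ℕ, bowenPre T f Z ε s N

/-- The critical value `M_ε(T, f, Z, d) = inf {s ∈ ℝ : M_ε^s = 0}`. -/
def bowenCritical (T : X → X) (f : X → ℝ) (Z : Set X) (ε : ℝ) : EReal :=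
  ⨅ (s : ℝ) (_ : bowenOuter T f Z ε s = 0), (s : EReal)

/-- The Bowen upper metric mean dimension with potential `f` on `Z`. -/
def bowenUpperMdim (T : X → X) (f : X → ℝ) (Z : Set X) : EReal :=
  limsup (fun ε : ℝ => bowenCritical T f Z ε / ((Real.log (1 / ε) : ℝ) : EReal)) (𝓝[>] 0)

/-- A countable pairwise disjoint family of closed Bowen balls of radius `ε` with `n_i ≥ N` and
centres `x_i ∈ Z`, given as the set of its pairs `(n_i, x_i)`. (For `ε > 0` the balls are nonempty,
so that members of a disjoint family with different indices have different pairs.) -/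
def IsBowenPacking (T : X → X) (Z : Set X) (ε : ℝ) (N : ℕ) (C : Set (ℕ × X)) : Prop :=
  C.Countable ∧ (∀ p ∈ C, N ≤ p.1 ∧ p.2 ∈ Z) ∧
    C.PairwiseDisjoint fun p => closedBowenBall T p.1 p.2 ε

/-- `P_{N,ε}^s(T, f, Z, d)`. -/
def packingPre (T : X → X) (f : X → ℝ) (Z : Set X) (ε s : ℝ) (N : ℕ) : ℝ≥0∞ :=
  ⨆ (C : Set (ℕ × X)) (_ : IsBowenPacking T Z ε N C), ∑' p : C, ballWeight T f ε s p

/-- `P_ε^s(T, f, Z, d)`: the limit of `P_{N,ε}^s` as `N → ∞`, which is an infimum because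
`P_{N,ε}^s` is nonincreasing in `N`. -/
def packingLim (T : X → X) (f : X → ℝ) (Z : Set X) (ε s : ℝ) : ℝ≥0∞ :=
  ⨅ N : ℕ, packingPre T f Z ε s N

/-- `𝒫_ε^s(T, f, Z, d) = inf {∑_i P_ε^s(T, f, Z_i, d) : Z ⊆ ⋃_i Z_i}`. -/
def packingOuter (T : X → X) (f : X → ℝ) (Z : Set X) (ε s : ℝ) : ℝ≥0∞ :=
  ⨅ (A : ℕ → Set X) (_ : Z ⊆ ⋃ i, A i), ∑' i, packingLim T f (A i) ε s

/-- The critical value `𝒫_ε(T, f, Z, d) = inf {s ∈ ℝ : 𝒫_ε^s = 0}`. -/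
def packingCritical (T : X → X) (f : X → ℝ) (Z : Set X) (ε : ℝ) : EReal :=
  ⨅ (s : ℝ) (_ : packingOuter T f Z ε s = 0), (s : EReal)

/-- The packing upper metric mean dimension with potential `f` on `Z`. -/
def packingUpperMdim (T : X → X) (f : X → ℝ) (Z : Set X) : EReal :=
  limsup (fun ε : ℝ => packingCritical T f Z ε / ((Real.log (1 / ε) : ℝ) : EReal)) (𝓝[>] 0)

end MeanDim

end

/-!
For every `Z` one has Bowen ≤ packing ≤ spanning: a Vitali-type selection of disjoint closed balls
of radius `δ` covers at radius `3δ`, and the centres of disjoint balls inject into a spanning set.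
The rescaling of `δ` and the oscillation of `f` on Bowen balls cost only `o(log (1/δ))` in the
critical exponents.

Conversely, a finite cover of `X` by Bowen balls of total weight at most `1` can be concatenated
along orbits into covers of `X` of every length with bounded total weight, so on the whole space the
spanning dimension is at most the Bowen dimension. The Bowen dimension is finitely stable, and by
compactness finitely many of the given neighbourhoods cover `X`; hence one of them carries the full
Bowen dimension, and there all three quantities coincide with the dimension of `X`.
-/

namespace MeanDim

section ScaledLimsup

lemma tendsto_log_one_div_nhdsGT_zero :
    Tendsto (fun δ : ℝ => Real.log (1 / δ)) (𝓝[>] 0) atTop := by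
  simpa only [one_div, Function.comp_def] using
    Real.tendsto_log_atTop.comp tendsto_inv_nhdsGT_zero

lemma log_one_div_mul {k δ : ℝ} (hk : k ≠ 0) (hδ : δ ≠ 0) :
    Real.log (1 / (k * δ)) = Real.log (1 / δ) - Real.log k := by
  rw [one_div, one_div, Real.log_inv, Real.log_inv, Real.log_mul hk hδ]
  ring

lemma limsup_div_log_le_limsup_div_log {F G : ℝ → EReal} {k C : ℝ} (hk : 0 < k)
    (h : ∀ η > 0, ∀ᶠ δ in 𝓝[>] (0 : ℝ),
      F (k * δ) ≤ G δ + ((η * Real.log (1 / δ) + C : ℝ) : EReal)) :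
    limsup (fun δ : ℝ => F δ / ((Real.log (1 / δ) : ℝ) : EReal)) (𝓝[>] 0) ≤
      limsup (fun δ : ℝ => G δ / ((Real.log (1 / δ) : ℝ) : EReal)) (𝓝[>] 0) := by
  refine EReal.le_of_forall_lt_iff_le.1 fun b hb => ?_
  obtain ⟨a, ha, hab⟩ := EReal.exists_between_coe_real hb
  have hη : 0 < (b - a) / 2 := half_pos (sub_pos.2 (EReal.coe_lt_coe_iff.1 hab))
  suffices hscaled : ∀ᶠ δ in 𝓝[>] (0 : ℝ),
      F (k * δ) / ((Real.log (1 / (k * δ)) : ℝ) : EReal) ≤ b by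
    refine limsup_le_of_le (h := ?_)
    simpa only [mul_inv_cancel_left₀ hk.ne'] using
      eventually_nhdsGT_zero_mul_left (inv_pos.2 hk) hscaled
  filter_upwards [h _ hη, eventually_lt_of_limsup_lt ha, self_mem_nhdsWithin,
    tendsto_log_one_div_nhdsGT_zero.eventually_gt_atTop (max 0 (Real.log k)),
    tendsto_log_one_div_nhdsGT_zero.eventually_ge_atTop ((b * Real.log k + C) / ((b - a) / 2))]
    with δ hF hG hδ hlog hlarge
  obtain ⟨hlog_pos, hlog_k⟩ := max_lt_iff.1 hlog
  rw [EReal.div_lt_iff (EReal.coe_pos.2 hlog_pos) (EReal.coe_ne_top _)] at hG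
  rw [log_one_div_mul hk.ne' (Set.mem_Ioi.1 hδ).ne',
    EReal.div_le_iff_le_mul (EReal.coe_pos.2 (sub_pos.2 hlog_k)) (EReal.coe_ne_top _)]
  refine hF.trans ((add_le_add_left hG.le _).trans ?_)
  rw [div_le_iff₀ hη] at hlarge
  norm_cast
  linarith

end ScaledLimsup

lemma iInf_tsum_le_tsum_iInf {ι α : Type*} [Countable ι] {P : ι → Set α → Prop}
    {Q : Set α → Prop} (h : ∀ C : ι → Set α, (∀ i, P i (C i)) → Q (⋃ i, C i)) (w : α → ℝ≥0∞) :
    ⨅ (D) (_ : Q D), ∑' a : D, w a ≤ ∑' i, ⨅ (C) (_ : P i C), ∑' a : C, w a := by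
  refine ENNReal.le_of_forall_pos_le_add fun ε hε hfin => ?_
  obtain ⟨e, he, he_sum⟩ := ENNReal.exists_pos_sum_of_countable' (ENNReal.coe_ne_zero.2 hε.ne') ι
  have hnear : ∀ i, ∃ C, P i C ∧
      ∑' a : C, w a < (⨅ (C) (_ : P i C), ∑' a : C, w a) + e i := fun i => by
    have := ENNReal.lt_add_right (ENNReal.ne_top_of_tsum_ne_top hfin.ne i) (he i).ne'
    simpa only [iInf_lt_iff, exists_prop] using this
  choose C hC hCw using hnear
  calc ⨅ (D) (_ : Q D), ∑' a : D, w a ≤ ∑' a : ⋃ i, C i, w a := iInf₂_le _ (h C hC)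
    _ ≤ ∑' i, ∑' a : C i, w a := ENNReal.tsum_iUnion_le_tsum _ _
    _ ≤ ∑' i, ((⨅ (C) (_ : P i C), ∑' a : C, w a) + e i) :=
        ENNReal.tsum_le_tsum fun i => (hCw i).le
    _ = ∑' i, (⨅ (C) (_ : P i C), ∑' a : C, w a) + ∑' i, e i := ENNReal.tsum_add
    _ ≤ ∑' i, (⨅ (C) (_ : P i C), ∑' a : C, w a) + ε := by gcongr

section BowenMetric

variable {X : Type*} [MetricSpace X] {T : X → X}

lemma dist_iterate_le_bowenDist {j n : ℕ} (hj : j < n) (x y : X) :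
    dist (T^[j] x) (T^[j] y) ≤ bowenDist T n x y :=
  NNReal.coe_le_coe.2 (Finset.le_sup (f := fun j => nndist (T^[j] x) (T^[j] y))
    (Finset.mem_range.2 hj))

lemma bowenDist_self (T : X → X) (n : ℕ) (x : X) : bowenDist T n x x = 0 := by
  simp [bowenDist]

lemma bowenDist_comm (T : X → X) (n : ℕ) (x y : X) : bowenDist T n x y = bowenDist T n y x := by
  simp only [bowenDist, nndist_comm]

lemma bowenDist_triangle (T : X → X) (n : ℕ) (x y z : X) :
    bowenDist T n x z ≤ bowenDist T n x y + bowenDist T n y z :=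
  NNReal.coe_le_coe.2 <| Finset.sup_le fun j hj =>
    (nndist_triangle _ (T^[j] y) _).trans <| add_le_add
      (Finset.le_sup (f := fun j => nndist (T^[j] x) (T^[j] y)) hj)
      (Finset.le_sup (f := fun j => nndist (T^[j] y) (T^[j] z)) hj)

lemma bowenDist_add_le_max (T : X → X) (k n : ℕ) (x y : X) :
    bowenDist T (k + n) x y ≤ max (bowenDist T k x y) (bowenDist T n (T^[k] x) (T^[k] y)) := by
  rw [bowenDist, bowenDist, bowenDist, ← NNReal.coe_max, NNReal.coe_le_coe]
  refine Finset.sup_le fun j hj => ?_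
  rcases lt_or_ge j k with hjk | hkj
  · exact le_max_of_le_left (Finset.le_sup (f := fun j => nndist (T^[j] x) (T^[j] y))
      (Finset.mem_range.2 hjk))
  · obtain ⟨i, rfl⟩ := Nat.exists_eq_add_of_le' hkj
    have hi : i ∈ Finset.range n := by simp only [Finset.mem_range] at hj ⊢; omega
    rw [Function.iterate_add_apply, Function.iterate_add_apply]
    exact le_max_of_le_right
      (Finset.le_sup (f := fun i => nndist (T^[i] (T^[k] x)) (T^[i] (T^[k] y))) hi)

lemma mem_bowenBall_self (T : X → X) (n : ℕ) (x : X) {r : ℝ} (hr : 0 < r) :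
    x ∈ bowenBall T n x r :=
  (bowenDist_self T n x).trans_lt hr

lemma bowenDist_lt_two_mul_of_mem_bowenBall {n : ℕ} {x y z : X} {r : ℝ}
    (hy : y ∈ bowenBall T n x r) (hz : z ∈ bowenBall T n x r) : bowenDist T n y z < 2 * r :=
  calc bowenDist T n y z ≤ bowenDist T n x y + bowenDist T n x z :=
        bowenDist_comm T n x y ▸ bowenDist_triangle T n y x z
    _ < r + r := add_lt_add hy hz
    _ = 2 * r := (two_mul r).symm

lemma bowenBall_subset_closedBowenBall (T : X → X) (n : ℕ) (x : X) (r : ℝ) :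
    bowenBall T n x r ⊆ closedBowenBall T n x r :=
  fun y (hy : bowenDist T n x y < r) => hy.le

lemma continuous_bowenDist (hT : Continuous T) (n : ℕ) (x : X) :
    Continuous fun y => bowenDist T n x y :=
  NNReal.continuous_coe.comp <| Continuous.finset_sup_apply fun j _ =>
    continuous_const.nndist (hT.iterate j)

lemma isOpen_bowenBall (hT : Continuous T) (n : ℕ) (x : X) (r : ℝ) :
    IsOpen (bowenBall T n x r) :=
  isOpen_lt (continuous_bowenDist hT n x) continuous_const

end BowenMetric

section BallWeight

variable {X : Type*} {T : X → X} {f : X → ℝ} {δ s : ℝ}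

lemma abs_birkhoffSum_le {B : ℝ} (hB : ∀ x, |f x| ≤ B) (n : ℕ) (x : X) :
    |birkhoffSum T f n x| ≤ n * B :=
  calc |birkhoffSum T f n x| ≤ ∑ j ∈ Finset.range n, |f (T^[j] x)| :=
        Finset.abs_sum_le_sum_abs _ _
    _ ≤ ∑ _j ∈ Finset.range n, B := Finset.sum_le_sum fun j _ => hB _
    _ = n * B := by simp

lemma birkhoffSum_le_add_of_bowenDist_le [MetricSpace X] {η : ℝ}
    (hη : ∀ x y, dist x y ≤ δ → |f x - f y| ≤ η) {n : ℕ} {x y : X}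
    (hxy : bowenDist T n x y ≤ δ) : birkhoffSum T f n x ≤ birkhoffSum T f n y + n * η :=
  calc birkhoffSum T f n x ≤ ∑ j ∈ Finset.range n, (f (T^[j] y) + η) :=
        Finset.sum_le_sum fun j hj => sub_le_iff_le_add'.1 <| (le_abs_self _).trans <|
          hη _ _ <| (dist_iterate_le_bowenDist (Finset.mem_range.1 hj) x y).trans hxy
    _ = birkhoffSum T f n y + n * η := by simp [birkhoffSum, Finset.sum_add_distrib]

lemma ballWeight_ne_zero (p : ℕ × X) : ballWeight T f δ s p ≠ 0 :=
  (ENNReal.ofReal_pos.2 (Real.exp_pos _)).ne'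

lemma ballWeight_ne_top (p : ℕ × X) : ballWeight T f δ s p ≠ ∞ :=
  ENNReal.ofReal_ne_top

lemma antitone_ballWeight (p : ℕ × X) : Antitone fun s => ballWeight T f δ s p := fun s t hst => by
  have := mul_le_mul_of_nonneg_left hst (Nat.cast_nonneg (α := ℝ) p.1)
  exact ENNReal.ofReal_le_ofReal (Real.exp_le_exp.2 (by linarith))

lemma ofReal_one_div_rpow_birkhoffSum (hδ : 0 < δ) (n : ℕ) (x : X) :
    ENNReal.ofReal ((1 / δ) ^ birkhoffSum T f n x) = ballWeight T f δ 0 (n, x) := by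
  rw [Real.rpow_def_of_pos (by positivity), ballWeight, mul_zero, zero_add]

lemma ballWeight_add_right (s t : ℝ) (p : ℕ × X) :
    ballWeight T f δ (s + t) p = ENNReal.ofReal (Real.exp (-t)) ^ p.1 * ballWeight T f δ s p := by
  rw [ballWeight, ballWeight, ← ENNReal.ofReal_pow (Real.exp_nonneg _),
    ← ENNReal.ofReal_mul (by positivity), ← Real.exp_nat_mul, ← Real.exp_add]
  ring_nf

lemma ballWeight_iterate_add (k n : ℕ) (x : X) :
    ballWeight T f δ s (k + n, x) =
      ballWeight T f δ s (k, x) * ballWeight T f δ s (n, T^[k] x) := by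
  rw [ballWeight, ballWeight, ballWeight, ← ENNReal.ofReal_mul (Real.exp_nonneg _),
    ← Real.exp_add, birkhoffSum_add]
  push_cast
  ring_nf

lemma ballWeight_mul_le {B k : ℝ} (hB : ∀ x, |f x| ≤ B) (hk : 1 ≤ k) (hδ : 0 < δ) (s : ℝ)
    (p : ℕ × X) : ballWeight T f (k * δ) (s + B * Real.log k) p ≤ ballWeight T f δ s p := by
  have hS := mul_le_mul_of_nonneg_left (neg_le_of_abs_le (abs_birkhoffSum_le (T := T) hB p.1 p.2))
    (Real.log_nonneg hk)
  refine ENNReal.ofReal_le_ofReal (Real.exp_le_exp.2 ?_)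
  rw [log_one_div_mul (by positivity) hδ.ne']
  linarith

lemma ofReal_one_div_mul_rpow_birkhoffSum_le {B k : ℝ} (hB : ∀ x, |f x| ≤ B) (hk : 1 ≤ k)
    (hδ : 0 < δ) (s : ℝ) (n : ℕ) (x : X) :
    ENNReal.ofReal ((1 / (k * δ)) ^ birkhoffSum T f n x) ≤
      ENNReal.ofReal (Real.exp (s + B * Real.log k)) ^ n * ballWeight T f δ s (n, x) := by
  have hsplit := ballWeight_add_right (T := T) (f := f) (δ := k * δ) (s + B * Real.log k)
    (-(s + B * Real.log k)) (n, x)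
  rw [add_neg_cancel, neg_neg] at hsplit
  rw [ofReal_one_div_rpow_birkhoffSum (by positivity), hsplit]
  gcongr
  exact ballWeight_mul_le hB hk hδ s (n, x)

lemma ballWeight_le_of_bowenDist_le [MetricSpace X] {η : ℝ} (hδ : 0 ≤ Real.log (1 / δ))
    (hη : ∀ x y, dist x y ≤ δ → |f x - f y| ≤ η) {n : ℕ} {x y : X}
    (hxy : bowenDist T n x y ≤ δ) :
    ballWeight T f δ (s + η * Real.log (1 / δ)) (n, x) ≤ ballWeight T f δ s (n, y) := by
  have hS := mul_le_mul_of_nonneg_left (birkhoffSum_le_add_of_bowenDist_le hη hxy) hδ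
  exact ENNReal.ofReal_le_ofReal (Real.exp_le_exp.2 (by dsimp only; linarith))

lemma iSup_ballWeight_ne_top {B : ℝ} (hB : ∀ x, |f x| ≤ B) (n : ℕ) :
    ⨆ y, ballWeight T f δ s (n, y) ≠ ∞ := by
  refine ne_top_of_le_ne_top (ENNReal.ofReal_ne_top
    (r := Real.exp (-(n : ℝ) * s + |Real.log (1 / δ)| * (n * B)))) (iSup_le fun y => ?_)
  have hS : Real.log (1 / δ) * birkhoffSum T f n y ≤ |Real.log (1 / δ)| * (n * B) :=
    (le_abs_self _).trans <| (abs_mul _ _).trans_le <| by gcongr; exact abs_birkhoffSum_le hB n y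
  exact ENNReal.ofReal_le_ofReal (Real.exp_le_exp.2 (by dsimp only; gcongr))

end BallWeight

lemma le_add_coe_of_forall_lt {x y : EReal} {c : ℝ}
    (h : ∀ s : ℝ, x < s → y ≤ ((s + c : ℝ) : EReal)) : y ≤ x + (c : EReal) := by
  have hbot := EReal.coe_ne_bot c
  have htop := EReal.coe_ne_top c
  refine (EReal.sub_le_iff_le_add (.inl hbot) (.inl htop)).1 ?_
  refine EReal.le_of_forall_lt_iff_le.1 fun s hs => ?_
  rw [EReal.sub_le_iff_le_add (.inl hbot) (.inl htop), ← EReal.coe_add]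
  exact h s hs

lemma eventually_forall_dist_le_abs_sub_le {X : Type*} [PseudoMetricSpace X] {f : X → ℝ}
    (hf : UniformContinuous f) {η : ℝ} (hη : 0 < η) :
    ∀ᶠ δ in 𝓝[>] (0 : ℝ), ∀ x y, dist x y ≤ δ → |f x - f y| ≤ η := by
  obtain ⟨r, hr, hfr⟩ := Metric.uniformContinuous_iff.1 hf η hη
  filter_upwards [Ioo_mem_nhdsGT hr] with δ hδ x y hxy
  exact (hfr (hxy.trans_lt hδ.2)).le

lemma eventually_log_one_div_pos : ∀ᶠ δ in 𝓝[>] (0 : ℝ), 0 < Real.log (1 / δ) :=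
  tendsto_log_one_div_nhdsGT_zero.eventually_gt_atTop 0

section PackingLeSpanning

variable {X : Type*} [MetricSpace X] {T : X → X} {f : X → ℝ} {δ η s : ℝ}

lemma tsum_ballWeight_le_spanningSum {A Z : Set X} {n : ℕ} (hAZ : A ⊆ Z)
    (hA : A.PairwiseDisjoint fun x => closedBowenBall T n x δ) (hδ : 0 < δ)
    (hlog : 0 ≤ Real.log (1 / δ)) (hη : ∀ x y, dist x y ≤ δ → |f x - f y| ≤ η) :
    ∑' x : A, ballWeight T f δ (s + η * Real.log (1 / δ)) (n, x) ≤
      ENNReal.ofReal (Real.exp (-s)) ^ n * spanningSum T f Z δ n := by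
  have hexp_ne_zero : ENNReal.ofReal (Real.exp (-s)) ^ n ≠ 0 := by positivity
  have hexp_ne_top : ENNReal.ofReal (Real.exp (-s)) ^ n ≠ ∞ := by finiteness
  simp only [spanningSum, ENNReal.mul_iInf_of_ne hexp_ne_zero hexp_ne_top]
  refine le_iInf₂ fun E hE => ?_
  choose y hyE hxy using fun x : A => hE x (hAZ x.2)
  have hy_inj : Function.Injective fun x : A => (⟨y x, hyE x⟩ : E) := fun a b hab => by
    have hyab : y a = y b := congrArg Subtype.val hab
    have hb : bowenDist T n b (y a) < δ := hyab ▸ hxy b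
    exact Subtype.ext (hA.elim_set a.2 b.2 (y a) (hxy a).le hb.le)
  calc ∑' x : A, ballWeight T f δ (s + η * Real.log (1 / δ)) (n, x)
      ≤ ∑' x : A, ballWeight T f δ s (n, y x) :=
        ENNReal.tsum_le_tsum fun x => ballWeight_le_of_bowenDist_le hlog hη (hxy x).le
    _ ≤ ∑' z : E, ballWeight T f δ s (n, z) :=
        ENNReal.tsum_comp_le_tsum_of_injective hy_inj fun z : E => ballWeight T f δ s (n, z)
    _ = _ := by
        simp only [← ENNReal.tsum_mul_left, ofReal_one_div_rpow_birkhoffSum hδ,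
          ← ballWeight_add_right 0 s (n, _), zero_add]

lemma tsum_subtype_prod {α β : Type*} (C : Set (α × β)) (w : α × β → ℝ≥0∞) :
    ∑' p : C, w p = ∑' a, ∑' b : Prod.mk a ⁻¹' C, w (a, b) := by
  rw [tsum_subtype, ENNReal.tsum_prod']
  exact tsum_congr fun a => (tsum_subtype (Prod.mk a ⁻¹' C) fun b => w (a, b)).symm

lemma packingPre_le_tsum_spanningSum (Z : Set X) (hδ : 0 < δ)
    (hlog : 0 ≤ Real.log (1 / δ)) (hη : ∀ x y, dist x y ≤ δ → |f x - f y| ≤ η) (N : ℕ) :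
    packingPre T f Z δ (s + η * Real.log (1 / δ)) N ≤
      ∑' k, ENNReal.ofReal (Real.exp (-s)) ^ (k + N) * spanningSum T f Z δ (k + N) := by
  refine iSup₂_le fun C hC => ?_
  have hshort : ∀ k ∈ Finset.range N, ∑' x : Prod.mk k ⁻¹' C,
      ballWeight T f δ (s + η * Real.log (1 / δ)) (k, x) = 0 := fun k hk => by
    have : Prod.mk k ⁻¹' C = ∅ := Set.eq_empty_of_forall_notMem fun x hx =>
      (hC.2.1 _ hx).1.not_gt (Finset.mem_range.1 hk)
    rw [this, tsum_empty]
  rw [tsum_subtype_prod, ← ENNReal.summable.sum_add_tsum_nat_add' (k := N),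
    Finset.sum_eq_zero hshort, zero_add]
  refine ENNReal.tsum_le_tsum fun k => tsum_ballWeight_le_spanningSum
    (fun x hx => (hC.2.1 _ hx).2) (fun x hx y hy hxy => ?_) hδ hlog hη
  exact hC.2.2 hx hy fun h => hxy (congrArg Prod.snd h)

lemma tendsto_tsum_exp_mul_of_expGrowthSup_lt {u : ℕ → ℝ≥0∞} (h : ExpGrowth.expGrowthSup u < s) :
    Tendsto (fun N => ∑' k, ENNReal.ofReal (Real.exp (-s)) ^ (k + N) * u (k + N)) atTop (𝓝 0) := by
  obtain ⟨t, hut, hts⟩ := EReal.exists_between_coe_real h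
  have hts : t - s < 0 := sub_neg.2 (EReal.coe_lt_coe_iff.1 hts)
  have hgeom : ∑' k, ENNReal.ofReal (Real.exp (t - s)) ^ k ≠ ∞ := by
    rw [ENNReal.tsum_geometric]
    refine ENNReal.inv_ne_top.2 (tsub_pos_of_lt ?_).ne'
    rwa [ENNReal.ofReal_lt_one, Real.exp_lt_one_iff]
  have hterm : ∀ᶠ n in atTop,
      ENNReal.ofReal (Real.exp (-s)) ^ n * u n ≤ ENNReal.ofReal (Real.exp (t - s)) ^ n := by
    filter_upwards [ExpGrowth.eventually_le_exp hut] with n hn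
    rw [mul_comm (t : EReal), ← EReal.coe_natCast, ← EReal.coe_mul, EReal.exp_coe,
      Real.exp_nat_mul, ENNReal.ofReal_pow (Real.exp_nonneg _)] at hn
    calc _ ≤ ENNReal.ofReal (Real.exp (-s)) ^ n * ENNReal.ofReal (Real.exp t) ^ n := by gcongr
      _ = ENNReal.ofReal (Real.exp (t - s)) ^ n := by
          rw [← mul_pow, ← ENNReal.ofReal_mul (Real.exp_nonneg _), ← Real.exp_add,
            neg_add_eq_sub]
  obtain ⟨N₀, hN₀⟩ := eventually_atTop.1 hterm
  refine tendsto_of_tendsto_of_tendsto_of_le_of_le' tendsto_const_nhds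
    (ENNReal.tendsto_sum_nat_add _ hgeom) (Eventually.of_forall fun _ => zero_le) ?_
  filter_upwards [eventually_ge_atTop N₀] with N hN
  exact ENNReal.tsum_le_tsum fun k => hN₀ _ (le_add_left hN)

lemma packingCritical_le_spanningPressure (Z : Set X) (hδ : 0 < δ)
    (hlog : 0 ≤ Real.log (1 / δ)) (hη : ∀ x y, dist x y ≤ δ → |f x - f y| ≤ η) :
    packingCritical T f Z δ ≤
      spanningPressure T f Z δ + ((η * Real.log (1 / δ) : ℝ) : EReal) := by
  refine le_add_coe_of_forall_lt fun s hs => iInf₂_le _ ?_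
  have hlim : packingLim T f Z δ (s + η * Real.log (1 / δ)) = 0 :=
    nonpos_iff_eq_zero.1 <| ge_of_tendsto' (tendsto_tsum_exp_mul_of_expGrowthSup_lt hs) fun N =>
      (iInf_le _ N).trans (packingPre_le_tsum_spanningSum Z hδ hlog hη N)
  refine nonpos_iff_eq_zero.1 ((iInf₂_le (fun _ => Z) (Set.iUnion_const Z).ge).trans_eq ?_)
  simp only [hlim, tsum_zero]

theorem packingUpperMdim_le_upperMdim (T : X → X) (hf : UniformContinuous f) (Z : Set X) :
    packingUpperMdim T f Z ≤ upperMdim T f Z := by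
  refine limsup_div_log_le_limsup_div_log one_pos (C := 0) fun η hη => ?_
  filter_upwards [eventually_forall_dist_le_abs_sub_le hf hη, eventually_log_one_div_pos,
    self_mem_nhdsWithin] with δ hosc hlog hδ
  rw [one_mul, add_zero]
  exact packingCritical_le_spanningPressure Z hδ hlog.le hosc

end PackingLeSpanning

section CountableSubadditivity

variable {X ι : Type*} [MetricSpace X] {T : X → X} {f : X → ℝ} [Countable ι] {Z : Set X}
  {A : ι → Set X}

lemma bowenPre_le_tsum (hZ : Z ⊆ ⋃ i, A i) (δ s : ℝ) (N : ℕ) :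
    bowenPre T f Z δ s N ≤ ∑' i, bowenPre T f (A i) δ s N :=
  iInf_tsum_le_tsum_iInf (fun C hC => by
    refine ⟨Set.countable_iUnion fun i => (hC i).1, fun p hp => ?_, ?_⟩
    · obtain ⟨i, hi⟩ := Set.mem_iUnion.1 hp
      exact (hC i).2.1 p hi
    · rw [Set.biUnion_iUnion]
      exact hZ.trans (Set.iUnion_mono fun i => (hC i).2.2)) _

lemma bowenOuter_le_tsum (hZ : Z ⊆ ⋃ i, A i) (δ s : ℝ) :
    bowenOuter T f Z δ s ≤ ∑' i, bowenOuter T f (A i) δ s :=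
  iSup_le fun N => (bowenPre_le_tsum hZ δ s N).trans <|
    ENNReal.tsum_le_tsum fun i => le_iSup (fun N => bowenPre T f (A i) δ s N) N

end CountableSubadditivity

lemma antitone_bowenOuter {X : Type*} [MetricSpace X] (T : X → X) (f : X → ℝ) (Z : Set X)
    (δ : ℝ) : Antitone (bowenOuter T f Z δ) := fun _ _ hst =>
  iSup_mono fun _ => le_iInf₂ fun C hC => (iInf₂_le C hC).trans <|
    ENNReal.tsum_le_tsum fun p => antitone_ballWeight p.1 hst

lemma bowenOuter_eq_zero_of_bowenCritical_lt {X : Type*} [MetricSpace X] {T : X → X} {f : X → ℝ}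
    {Z : Set X} {δ s : ℝ} (h : bowenCritical T f Z δ < s) : bowenOuter T f Z δ s = 0 := by
  simp only [bowenCritical, iInf_lt_iff] at h
  obtain ⟨t, ht, hts⟩ := h
  exact nonpos_iff_eq_zero.1 <|
    (antitone_bowenOuter T f Z δ (EReal.coe_lt_coe_iff.1 hts).le).trans_eq ht

section BowenLePacking

variable {X : Type*} [MetricSpace X] [TopologicalSpace.SeparableSpace X] {T : X → X} {f : X → ℝ}
  {δ : ℝ}

lemma exists_countable_pairwiseDisjoint_closedBowenBall (hT : Continuous T)
    (n : ℕ) (hδ : 0 < δ) (A : Set X) :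
    ∃ u ⊆ A, u.Countable ∧ u.PairwiseDisjoint (fun x => closedBowenBall T n x δ) ∧
      A ⊆ ⋃ x ∈ u, bowenBall T n x (3 * δ) := by
  have hself : ∀ x, x ∈ bowenBall T n x δ := fun x => mem_bowenBall_self T n x hδ
  have hsub : ∀ x, bowenBall T n x δ ⊆ closedBowenBall T n x δ := fun x =>
    bowenBall_subset_closedBowenBall T n x δ
  obtain ⟨u, huA, hdisj, hmeet⟩ := Vitali.exists_disjoint_subfamily_covering_enlargement
    (fun x => closedBowenBall T n x δ) A (fun _ => 0) 2 one_lt_two (fun _ _ => le_rfl) 0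
    (fun _ _ => le_rfl) fun x _ => ⟨x, hsub x (hself x)⟩
  refine ⟨u, huA, (hdisj.mono hsub).countable_of_isOpen
    (fun x _ => isOpen_bowenBall hT n x δ) fun x _ => ⟨x, hself x⟩, hdisj, fun x hx => ?_⟩
  obtain ⟨y, hy, ⟨z, hxz, hyz⟩, -⟩ := hmeet x hx
  refine Set.mem_iUnion₂.2 ⟨y, hy, ?_⟩
  calc bowenDist T n y x ≤ bowenDist T n y z + bowenDist T n x z :=
        bowenDist_comm T n x z ▸ bowenDist_triangle T n y z x
    _ ≤ δ + δ := add_le_add hyz hxz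
    _ < 3 * δ := by linarith

lemma bowenPre_le_packingPre (hT : Continuous T) {B : ℝ}
    (hB : ∀ x, |f x| ≤ B) (hδ : 0 < δ) (A : Set X) (s : ℝ) (N N' : ℕ) :
    bowenPre T f A (3 * δ) (s + B * Real.log 3) N ≤ packingPre T f A δ s N' := by
  obtain ⟨u, huA, hu, hdisj, hcover⟩ :=
    exists_countable_pairwiseDisjoint_closedBowenBall hT (max N N') hδ A
  set C : Set (ℕ × X) := Prod.mk (max N N') '' u
  have hC : C.Countable := hu.image _
  have hC_cover : IsBowenCover T A (3 * δ) N C :=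
    ⟨hC, Set.forall_mem_image.2 fun _ _ => le_max_left _ _, by rwa [Set.biUnion_image]⟩
  have hC_packing : IsBowenPacking T A δ N' C :=
    ⟨hC, Set.forall_mem_image.2 fun _ hx => ⟨le_max_right _ _, huA hx⟩,
      (Prod.mk_right_injective _).injOn.pairwiseDisjoint_image.2 hdisj⟩
  calc bowenPre T f A (3 * δ) (s + B * Real.log 3) N
      ≤ ∑' p : C, ballWeight T f (3 * δ) (s + B * Real.log 3) p := iInf₂_le C hC_cover
    _ ≤ ∑' p : C, ballWeight T f δ s p :=
        ENNReal.tsum_le_tsum fun p => ballWeight_mul_le hB (by norm_num) hδ s p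
    _ ≤ packingPre T f A δ s N' :=
        le_iSup₂ (f := fun C (_ : IsBowenPacking T A δ N' C) => ∑' p : C, ballWeight T f δ s p)
          C hC_packing

lemma bowenOuter_le_packingOuter (hT : Continuous T) {B : ℝ}
    (hB : ∀ x, |f x| ≤ B) (hδ : 0 < δ) (Z : Set X) (s : ℝ) :
    bowenOuter T f Z (3 * δ) (s + B * Real.log 3) ≤ packingOuter T f Z δ s :=
  le_iInf₂ fun A hA => (bowenOuter_le_tsum hA _ _).trans <| ENNReal.tsum_le_tsum fun i =>
    iSup_le fun N => le_iInf fun N' => bowenPre_le_packingPre hT hB hδ (A i) s N N'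

lemma bowenCritical_le_packingCritical (hT : Continuous T) {B : ℝ}
    (hB : ∀ x, |f x| ≤ B) (hδ : 0 < δ) (Z : Set X) :
    bowenCritical T f Z (3 * δ) ≤ packingCritical T f Z δ + ((B * Real.log 3 : ℝ) : EReal) := by
  refine le_add_coe_of_forall_lt fun s hs => ?_
  simp only [packingCritical, iInf_lt_iff] at hs
  obtain ⟨t, ht, hts⟩ := hs
  have hzero : bowenOuter T f Z (3 * δ) (t + B * Real.log 3) = 0 :=
    nonpos_iff_eq_zero.1 ((bowenOuter_le_packingOuter hT hB hδ Z t).trans_eq ht)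
  refine (iInf₂_le (t + B * Real.log 3) hzero).trans (EReal.coe_le_coe_iff.2 ?_)
  gcongr
  exact (EReal.coe_lt_coe_iff.1 hts).le

theorem bowenUpperMdim_le_packingUpperMdim (hT : Continuous T) {B : ℝ}
    (hB : ∀ x, |f x| ≤ B) (Z : Set X) : bowenUpperMdim T f Z ≤ packingUpperMdim T f Z := by
  refine limsup_div_log_le_limsup_div_log three_pos (C := B * Real.log 3) fun η hη => ?_
  filter_upwards [eventually_log_one_div_pos, self_mem_nhdsWithin] with δ hlog hδ
  refine (bowenCritical_le_packingCritical hT hB hδ Z).trans (add_le_add_right ?_ _)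
  exact EReal.coe_le_coe_iff.2 (le_add_of_nonneg_left (mul_nonneg hη.le hlog.le))

end BowenLePacking

lemma upperMdim_mono {X : Type*} [MetricSpace X] (T : X → X) (f : X → ℝ) :
    Monotone (upperMdim T f) := fun Z Z' h => by
  refine limsup_le_limsup ?_
  filter_upwards [eventually_log_one_div_pos] with δ hlog
  refine EReal.div_le_div_right_of_nonneg (EReal.coe_nonneg.2 hlog.le) ?_
  refine ExpGrowth.expGrowthSup_monotone fun n => ?_
  exact le_iInf₂ fun E hE => iInf₂_le E fun x hx => hE x (h hx)

section CoverSum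

/-- `𝒱` is a cover of `Z` by sets of `d_n`-diameter less than `r`. -/
def IsSmallCover {X : Type*} [MetricSpace X] (T : X → X) (n : ℕ) (r : ℝ) (Z : Set X)
    (𝒱 : Set (Set X)) : Prop :=
  Z ⊆ ⋃₀ 𝒱 ∧ ∀ V ∈ 𝒱, ∀ y ∈ V, ∀ z ∈ V, bowenDist T n y z < r

/-- The infimum of `∑_{V ∈ 𝒱} sup_{y ∈ V} exp(-n s + log(1/δ) S_n f(y))` over the covers `𝒱` of `Z`
by sets of `d_n`-diameter less than `r`. It bounds `spanningSum`, and covers by sets, unlike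
spanning sets, can be concatenated along orbits, see `coverSum_bowenBall_add_le`. -/
noncomputable def coverSum {X : Type*} [MetricSpace X] (T : X → X) (f : X → ℝ) (Z : Set X)
    (r δ s : ℝ) (n : ℕ) : ℝ≥0∞ :=
  ⨅ (𝒱) (_ : IsSmallCover T n r Z 𝒱), ∑' V : 𝒱, ⨆ y ∈ (V : Set X), ballWeight T f δ s (n, y)

variable {X : Type*} [MetricSpace X] {T : X → X} {f : X → ℝ} {Z : Set X} {r δ s : ℝ} {n : ℕ}

lemma coverSum_le_tsum {ι : Type*} [Countable ι] {A : ι → Set X} (hZ : Z ⊆ ⋃ i, A i) :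
    coverSum T f Z r δ s n ≤ ∑' i, coverSum T f (A i) r δ s n :=
  iInf_tsum_le_tsum_iInf (fun 𝒱 h𝒱 => by
    refine ⟨hZ.trans ?_, fun V hV => ?_⟩
    · rw [Set.sUnion_iUnion]
      exact Set.iUnion_mono fun i => (h𝒱 i).1
    · obtain ⟨i, hi⟩ := Set.mem_iUnion.1 hV
      exact (h𝒱 i).2 V hi) fun V => ⨆ y ∈ V, ballWeight T f δ s (n, y)

lemma coverSum_le_iSup (hZ : ∀ y ∈ Z, ∀ z ∈ Z, bowenDist T n y z < r) :
    coverSum T f Z r δ s n ≤ ⨆ y ∈ Z, ballWeight T f δ s (n, y) := by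
  have hcover : IsSmallCover T n r Z {Z} :=
    ⟨(Set.sUnion_singleton Z).ge, fun V hV => Set.mem_singleton_iff.1 hV ▸ hZ⟩
  exact (iInf₂_le _ hcover).trans_eq
    (tsum_singleton Z fun V => ⨆ y ∈ V, ballWeight T f δ s (n, y))

lemma coverSum_univ_ne_top [CompactSpace X] (hT : Continuous T) {B : ℝ} (hB : ∀ x, |f x| ≤ B)
    (hr : 0 < r) : coverSum T f Set.univ r δ s n ≠ ∞ := by
  obtain ⟨t, ht⟩ := isCompact_univ.elim_finite_subcover (fun x => bowenBall T n x (r / 2))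
    (fun x => isOpen_bowenBall hT n x (r / 2))
    fun x _ => Set.mem_iUnion.2 ⟨x, mem_bowenBall_self T n x (half_pos hr)⟩
  have hball : ∀ x, coverSum T f (bowenBall T n x (r / 2)) r δ s n ≠ ∞ := fun x =>
    ne_top_of_le_ne_top (iSup_ballWeight_ne_top hB n) <|
      (coverSum_le_iSup fun y hy z hz => by
        simpa only [mul_div_cancel₀ r two_ne_zero] using
          bowenDist_lt_two_mul_of_mem_bowenBall hy hz).trans
      (iSup_mono fun y => iSup_le fun _ => le_rfl)
  refine ne_top_of_le_ne_top ?_ (coverSum_le_tsum (ht.trans_eq (Set.biUnion_eq_iUnion _ _)))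
  rw [tsum_fintype]
  exact ENNReal.sum_ne_top.2 fun x _ => hball x

lemma spanningSum_le_coverSum {B k : ℝ} (hB : ∀ x, |f x| ≤ B) (hk : 1 ≤ k) (hδ : 0 < δ) :
    spanningSum T f Z (k * δ) n ≤
      ENNReal.ofReal (Real.exp (s + B * Real.log k)) ^ n * coverSum T f Z (k * δ) δ s n := by
  have hexp_ne_zero : ENNReal.ofReal (Real.exp (s + B * Real.log k)) ^ n ≠ 0 := by positivity
  have hexp_ne_top : ENNReal.ofReal (Real.exp (s + B * Real.log k)) ^ n ≠ ∞ := by finiteness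
  simp only [coverSum, ENNReal.mul_iInf_of_ne hexp_ne_zero hexp_ne_top]
  refine le_iInf₂ fun 𝒱 h𝒱 => ?_
  choose y hy using fun V : {V ∈ 𝒱 | V.Nonempty} => V.2.2
  have hspan : IsSpanningSet T n (k * δ) Z (Set.range y) := fun x hx => by
    obtain ⟨V, hV, hxV⟩ := h𝒱.1 hx
    exact ⟨y ⟨V, hV, x, hxV⟩, Set.mem_range_self _, h𝒱.2 V hV x hxV _ (hy ⟨V, hV, x, hxV⟩)⟩
  calc spanningSum T f Z (k * δ) n
      ≤ ∑' x : Set.range y, ENNReal.ofReal ((1 / (k * δ)) ^ birkhoffSum T f n (x : X)) :=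
        iInf₂_le _ hspan
    _ ≤ ∑' V, ENNReal.ofReal ((1 / (k * δ)) ^ birkhoffSum T f n (y V)) :=
        ENNReal.tsum_le_tsum_comp_of_surjective Set.rangeFactorization_surjective
          fun x : Set.range y => ENNReal.ofReal ((1 / (k * δ)) ^ birkhoffSum T f n (x : X))
    _ ≤ ∑' V : {V ∈ 𝒱 | V.Nonempty}, ENNReal.ofReal (Real.exp (s + B * Real.log k)) ^ n *
          ⨆ x ∈ (V : Set X), ballWeight T f δ s (n, x) :=
        ENNReal.tsum_le_tsum fun V => by
          refine (ofReal_one_div_mul_rpow_birkhoffSum_le hB hk hδ s n _).trans ?_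
          gcongr
          exact le_iSup₂ (f := fun x (_ : x ∈ V.1) => ballWeight T f δ s (n, x)) (y V) (hy V)
    _ ≤ ENNReal.ofReal (Real.exp (s + B * Real.log k)) ^ n *
          ∑' V : 𝒱, ⨆ x ∈ (V : Set X), ballWeight T f δ s (n, x) := by
        rw [ENNReal.tsum_mul_left]
        gcongr
        exact ENNReal.tsum_mono_subtype (fun V : Set X => ⨆ x ∈ V, ballWeight T f δ s (n, x))
          (Set.sep_subset 𝒱 Set.Nonempty)

lemma coverSum_bowenBall_add_le {η : ℝ} (hlog : 0 ≤ Real.log (1 / δ))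
    (hη : ∀ x y, dist x y ≤ δ → |f x - f y| ≤ η) (hr : 2 * δ ≤ r) (k n : ℕ) (x : X) :
    coverSum T f (bowenBall T k x δ) r δ (s + η * Real.log (1 / δ)) (k + n) ≤
      ballWeight T f δ s (k, x) *
        coverSum T f Set.univ r δ (s + η * Real.log (1 / δ)) n := by
  have hx_ne_zero := ballWeight_ne_zero (T := T) (f := f) (δ := δ) (s := s) (k, x)
  have hx_ne_top := ballWeight_ne_top (T := T) (f := f) (δ := δ) (s := s) (k, x)
  simp only [coverSum, ENNReal.mul_iInf_of_ne hx_ne_zero hx_ne_top]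
  refine le_iInf₂ fun 𝒱 h𝒱 => ?_
  -- A point of `B_k(x, δ)` whose `k`-th iterate lies in `V` follows `x` for time `k` and then `V`
  -- for time `n`.
  set follow : Set X → Set X := fun V => bowenBall T k x δ ∩ T^[k] ⁻¹' V
  have hcover : IsSmallCover T (k + n) r (bowenBall T k x δ) (follow '' 𝒱) := by
    refine ⟨fun y hy => ?_, Set.forall_mem_image.2 fun V hV y hy z hz => ?_⟩
    · obtain ⟨V, hV, hyV⟩ := h𝒱.1 (Set.mem_univ (T^[k] y))
      exact ⟨follow V, Set.mem_image_of_mem follow hV, hy, hyV⟩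
    · exact (bowenDist_add_le_max T k n y z).trans_lt <| max_lt
        ((bowenDist_lt_two_mul_of_mem_bowenBall hy.1 hz.1).trans_le hr) (h𝒱.2 V hV _ hy.2 _ hz.2)
  refine (iInf₂_le _ hcover).trans <| (ENNReal.tsum_le_tsum_comp_of_surjective
    (Set.imageFactorization_surjective (f := follow) (s := 𝒱)) fun W : follow '' 𝒱 =>
      ⨆ y ∈ W.1, ballWeight T f δ (s + η * Real.log (1 / δ)) (k + n, y)).trans ?_
  rw [← ENNReal.tsum_mul_left]
  refine ENNReal.tsum_le_tsum fun V => iSup₂_le fun y hy => ?_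
  rw [ballWeight_iterate_add]
  gcongr
  · exact ballWeight_le_of_bowenDist_le hlog hη (bowenDist_comm T k x y ▸ hy.1.le)
  · exact le_iSup₂ (f := fun z (_ : z ∈ V.1) => ballWeight T f δ _ (n, z)) (T^[k] y) hy.2

lemma exists_forall_coverSum_univ_le [CompactSpace X] (hT : Continuous T) {B η : ℝ}
    (hB : ∀ x, |f x| ≤ B) (hδ : 0 < δ) (hlog : 0 ≤ Real.log (1 / δ))
    (hη : ∀ x y, dist x y ≤ δ → |f x - f y| ≤ η) {F : Finset (ℕ × X)} (hF : ∀ p ∈ F, 1 ≤ p.1)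
    (hcover : Set.univ ⊆ ⋃ p ∈ F, bowenBall T p.1 p.2 δ)
    (hsum : ∑ p ∈ F, ballWeight T f δ s p ≤ 1) :
    ∃ D ≠ ∞, ∀ n, coverSum T f Set.univ (2 * δ) δ (s + η * Real.log (1 / δ)) n ≤ D := by
  set c : ℕ → ℝ≥0∞ := coverSum T f Set.univ (2 * δ) δ (s + η * Real.log (1 / δ))
  set N := F.sup Prod.fst
  refine ⟨(Finset.range (N + 1)).sup c, ?_, fun n => ?_⟩
  · rw [← lt_top_iff_ne_top, Finset.sup_lt_iff ENNReal.zero_lt_top]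
    exact fun n _ => (coverSum_univ_ne_top hT hB (by positivity)).lt_top
  induction n using Nat.strong_induction_on with
  | _ n ih =>
  rcases Nat.lt_or_ge n (N + 1) with hn | hn
  · exact Finset.le_sup (Finset.mem_range.2 hn)
  calc c n ≤ ∑ p ∈ F, coverSum T f (bowenBall T p.1 p.2 δ) (2 * δ) δ _ n := by
        rw [← Finset.tsum_subtype]
        exact coverSum_le_tsum (hcover.trans_eq (Set.biUnion_eq_iUnion _ _))
    _ ≤ ∑ p ∈ F, ballWeight T f δ s p * (Finset.range (N + 1)).sup c := by
        refine Finset.sum_le_sum fun p hp => ?_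
        have hp_pos := hF p hp
        have hp_le : p.1 ≤ N := Finset.le_sup (f := Prod.fst) hp
        obtain ⟨k, rfl⟩ := Nat.exists_eq_add_of_le (hp_le.trans (Nat.le_of_succ_le hn))
        refine (coverSum_bowenBall_add_le hlog hη le_rfl p.1 k p.2).trans ?_
        gcongr
        exact ih k (by omega)
    _ ≤ (Finset.range (N + 1)).sup c := by
        rw [← Finset.sum_mul]
        exact mul_le_of_le_one_left' hsum

end CoverSum

section SpanningLeBowen

variable {X : Type*} [MetricSpace X] [CompactSpace X] {T : X → X} {f : X → ℝ} {B : ℝ}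

lemma exists_finset_bowenBall_cover (hT : Continuous T) {δ s : ℝ}
    (h : bowenCritical T f Set.univ δ < s) :
    ∃ F : Finset (ℕ × X), (∀ p ∈ F, 1 ≤ p.1) ∧ Set.univ ⊆ ⋃ p ∈ F, bowenBall T p.1 p.2 δ ∧
      ∑ p ∈ F, ballWeight T f δ s p ≤ 1 := by
  have hpre : bowenPre T f Set.univ δ s 1 < 1 := by
    refine (le_iSup (bowenPre T f Set.univ δ s) 1).trans_lt ?_
    exact (bowenOuter_eq_zero_of_bowenCritical_lt h).trans_lt one_pos
  simp only [bowenPre, iInf_lt_iff] at hpre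
  obtain ⟨C, ⟨-, hC_one, hC_cover⟩, hC_sum⟩ := hpre
  obtain ⟨F, hFC, hF_finite, hF_cover⟩ := isCompact_univ.elim_finite_subcover_image
    (fun p _ => isOpen_bowenBall hT p.1 p.2 δ) hC_cover
  lift F to Finset (ℕ × X) using hF_finite
  refine ⟨F, fun p hp => hC_one p (hFC hp), hF_cover, ?_⟩
  rw [← Finset.tsum_subtype]
  exact (ENNReal.tsum_mono_subtype (ballWeight T f δ s) hFC).trans hC_sum.le

lemma spanningPressure_univ_le_bowenCritical_univ (hT : Continuous T) (hB : ∀ x, |f x| ≤ B)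
    {δ η : ℝ} (hδ : 0 < δ) (hlog : 0 ≤ Real.log (1 / δ))
    (hη : ∀ x y, dist x y ≤ δ → |f x - f y| ≤ η) :
    spanningPressure T f Set.univ (2 * δ) ≤ bowenCritical T f Set.univ δ +
      ((η * Real.log (1 / δ) + B * Real.log 2 : ℝ) : EReal) := by
  refine le_add_coe_of_forall_lt fun s hs => ?_
  obtain ⟨F, hF, hcover, hsum⟩ := exists_finset_bowenBall_cover hT hs
  obtain ⟨D, hD, hcoverSum⟩ := exists_forall_coverSum_univ_le hT hB hδ hlog hη hF hcover hsum
  set a := s + η * Real.log (1 / δ) + B * Real.log 2 with ha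
  calc spanningPressure T f Set.univ (2 * δ)
      ≤ ExpGrowth.expGrowthSup fun n => ENNReal.ofReal (Real.exp a) ^ n := by
        refine ExpGrowth.expGrowthSup_le_of_eventually_le hD (Eventually.of_forall fun n => ?_)
        exact (spanningSum_le_coverSum hB one_le_two hδ).trans <|
          (mul_le_mul_right (hcoverSum n) _).trans_eq (mul_comm _ _)
    _ = (a : EReal) := by
        rw [ExpGrowth.expGrowthSup_pow, ENNReal.log_ofReal_of_pos (Real.exp_pos _), Real.log_exp]
    _ = _ := by rw [ha, add_assoc]

theorem upperMdim_univ_le_bowenUpperMdim_univ (hT : Continuous T) (hf : Continuous f) :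
    upperMdim T f Set.univ ≤ bowenUpperMdim T f Set.univ := by
  obtain ⟨B, hB⟩ := isCompact_univ.exists_bound_of_continuousOn hf.continuousOn
  have hB : ∀ x, |f x| ≤ B := fun x => hB x trivial
  refine limsup_div_log_le_limsup_div_log two_pos (C := B * Real.log 2) fun η hη => ?_
  filter_upwards [eventually_forall_dist_le_abs_sub_le
    (CompactSpace.uniformContinuous_of_continuous hf) hη, eventually_log_one_div_pos,
    self_mem_nhdsWithin] with δ hosc hlog hδ
  exact spanningPressure_univ_le_bowenCritical_univ hT hB hδ hlog.le hosc

end SpanningLeBowen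

section FiniteStability

variable {X ι : Type*} [MetricSpace X] {T : X → X} {f : X → ℝ} {Z : Set X} {A : ι → Set X}

lemma bowenCritical_le_iSup [Countable ι] (hZ : Z ⊆ ⋃ i, A i) (δ : ℝ) :
    bowenCritical T f Z δ ≤ ⨆ i, bowenCritical T f (A i) δ := by
  refine EReal.le_of_forall_lt_iff_le.1 fun s hs => iInf₂_le s ?_
  refine nonpos_iff_eq_zero.1 ((bowenOuter_le_tsum hZ δ s).trans_eq ?_)
  exact ENNReal.tsum_eq_zero.2 fun i =>
    bowenOuter_eq_zero_of_bowenCritical_lt ((le_iSup _ i).trans_lt hs)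

lemma exists_bowenUpperMdim_le [Finite ι] [Nonempty ι] (hZ : Z ⊆ ⋃ i, A i) :
    ∃ i, bowenUpperMdim T f Z ≤ bowenUpperMdim T f (A i) := by
  cases nonempty_fintype ι
  obtain ⟨i, hi⟩ := exists_eq_ciSup_of_finite (f := fun i => bowenUpperMdim T f (A i))
  refine ⟨i, le_of_le_of_eq ?_ hi.symm⟩
  simp only [bowenUpperMdim]
  rw [← Finset.sup_univ_eq_iSup, ← limsup_finset_sup]
  refine limsup_le_limsup ?_
  filter_upwards [eventually_log_one_div_pos] with δ hlog
  have hlog_pos : (0 : EReal) < (Real.log (1 / δ) : ℝ) := EReal.coe_pos.2 hlog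
  rw [Finset.sup_univ_eq_iSup, EReal.div_le_iff_le_mul hlog_pos (EReal.coe_ne_top _)]
  refine (bowenCritical_le_iSup hZ δ).trans (iSup_le fun j => ?_)
  refine (EReal.div_le_iff_le_mul hlog_pos (EReal.coe_ne_top _)).1 ?_
  exact le_iSup (fun j => bowenCritical T f (A j) δ / ((Real.log (1 / δ) : ℝ) : EReal)) j

end FiniteStability

lemma stableBlock_mem_nhds {X : Type*} [MetricSpace X] {T : X → X} (hT : Continuous T) {ε : ℝ}
    (hε : 0 < ε) (m n : ℕ) (x : X) : stableBlock T ε m n x ∈ 𝓝 x := by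
  refine (eventually_all_finset (Finset.Icc m n)).2 fun j _ => ?_
  have hdist : Continuous fun y => dist (T^[j] x) (T^[j] y) := continuous_const.dist (hT.iterate j)
  exact hdist.continuousAt.eventually_le_const (by simpa only [dist_self] using hε)

end MeanDim

theorem theorem1p1_general {X : Type*} [MetricSpace X] [CompactSpace X] [Nonempty X]
    {T : X → X} (hT : Continuous T) {f : X → ℝ} (hf : Continuous f) {W : X → Set X}
    (hW : ∀ x, W x ∈ 𝓝 x) :
    IsGreatest (Set.range fun x => MeanDim.bowenUpperMdim T f (W x))
      (MeanDim.upperMdim T f Set.univ) ∧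
    IsGreatest (Set.range fun x => MeanDim.packingUpperMdim T f (W x))
      (MeanDim.upperMdim T f Set.univ) ∧
    IsGreatest (Set.range fun x => MeanDim.upperMdim T f (W x))
      (MeanDim.upperMdim T f Set.univ) := by
  obtain ⟨B, hB⟩ := isCompact_univ.exists_bound_of_continuousOn hf.continuousOn
  have hbp x := MeanDim.bowenUpperMdim_le_packingUpperMdim hT (fun y => hB y trivial) (W x)
  have hps x := MeanDim.packingUpperMdim_le_upperMdim T
    (CompactSpace.uniformContinuous_of_continuous hf) (W x)
  have hsu x := MeanDim.upperMdim_mono T f (Set.subset_univ (W x))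
  obtain ⟨t, -, ht⟩ := isCompact_univ.elim_nhds_subcover W fun x _ => hW x
  have ht_cover : Set.univ ⊆ ⋃ x : t, W x := ht.trans_eq (Set.biUnion_eq_iUnion _ _)
  have : Nonempty t := (Set.nonempty_iUnion.1 (Set.univ_nonempty.mono ht_cover)).nonempty
  obtain ⟨x, hx⟩ := MeanDim.exists_bowenUpperMdim_le (T := T) (f := f) ht_cover
  have hub := (MeanDim.upperMdim_univ_le_bowenUpperMdim_univ hT hf).trans hx
  exact ⟨⟨⟨x, (((hbp x).trans (hps x)).trans (hsu x)).antisymm hub⟩,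
      Set.forall_mem_range.2 fun y => ((hbp y).trans (hps y)).trans (hsu y)⟩,
    ⟨⟨x, ((hps x).trans (hsu x)).antisymm (hub.trans (hbp x))⟩,
      Set.forall_mem_range.2 fun y => (hps y).trans (hsu y)⟩,
    ⟨⟨x, (hsu x).antisymm ((hub.trans (hbp x)).trans (hps x))⟩, Set.forall_mem_range.2 hsu⟩⟩

theorem theorem1p1 {X : Type*} [MetricSpace X] [CompactSpace X] [Nonempty X]
    (T : X → X) (hT : Continuous T) (f : C(X, ℝ)) (ε : ℝ) (hε : 0 < ε) (m n : ℕ) (hmn : m ≤ n) :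
    IsGreatest
      (Set.range fun x : X => MeanDim.bowenUpperMdim T f (MeanDim.stableBlock T ε m n x))
      (MeanDim.upperMdim T f Set.univ) ∧
    IsGreatest
      (Set.range fun x : X => MeanDim.packingUpperMdim T f (MeanDim.stableBlock T ε m n x))
      (MeanDim.upperMdim T f Set.univ) ∧
    IsGreatest
      (Set.range fun x : X => MeanDim.upperMdim T f (MeanDim.stableBlock T ε m n x))
      (MeanDim.upperMdim T f Set.univ) :=
  theorem1p1_general hT f.continuous (MeanDim.stableBlock_mem_nhds hT hε m n)
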